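/- Let $d>0$ be a constant, and for each integer $n\ge d$, $n \geq 1$, let $G_{n,p}$ with $p=d/n$ be the binomial random graph on the vertex set $[n]=\{1,\dots,n\}$, in which each of the $\binom n2$ pairs of vertices is an edge independently with probability $p$. For a graph $G$, let $G^2$ be the graph on the same vertex set in which two distinct vertices are adjacent if and only if they are connected in $G$ by a path with at most two edges; let $\Delta(G)$ denote the maximum degree and $\chi(G)$ the chromatic number of $G$. Then, with high probability, $\chi(G_{n,p}^2)=\Delta(G_{n,p})+1$; that is, $$\lim_{n\to\infty}\mathbb{P}\left[\chi(G_{n,p}^2)=\Delta(G_{n,p})+1\right]=1.$$ -/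

import Mathlib

open Filter Topology MeasureTheory

/-- The `r`th power of a graph `G`: two distinct vertices are adjacent when they are connected in
`G` by a path with at most `r` edges. -/
def SimpleGraph.power {V : Type*} (G : SimpleGraph V) (r : ℕ) : SimpleGraph V where
  Adj u v := u ≠ v ∧ ∃ w : G.Walk u v, w.IsPath ∧ w.length ≤ r
  symm := ⟨fun _ _ ⟨hne, w, hw, hr⟩ => ⟨hne.symm, w.reverse, hw.reverse, by simpa using hr⟩⟩
  loopless := ⟨fun _ h => h.1 rfl⟩

/-!
# The chromatic number of the square of a sparse random graph

The lower bound `χ(G²) ≥ Δ + 1` holds because a vertex and its neighbours form a clique in `G²`.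

For the upper bound fix a large constant `m`, and call a vertex high if its degree exceeds `m`. As
the maximum degree tends to infinity (`tendsto_forall_degree_lt`), a vertex which is neither high nor
adjacent to a high vertex has at most `m² < Δ + 1` neighbours in `G²` and can be coloured greedily at
the end. It remains to colour the square of `G[W]`, where `W` is the set of vertices within distance
two of a high vertex. The square of a tree can be coloured with `Δ + 1` colours from the root
outwards, as the vertices within distance two of `v` that are coloured before `v` are its parent `p`
and neighbours of `p`. The same works outwards from a cycle, whose own square has degree at most four
(`colorable_squareOn_of_locally_unicyclic`). So it suffices that every component of `G[W]` has at most
one cycle.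

With high probability, connected sets of at most `c log n` vertices span at most one cycle
(`exists_locally_unicyclic`), and the closed neighbourhood of a connected set of `η log n` vertices
has at most `ε log n` vertices, for `η` small in terms of `ε` (`exists_expansion`). Both are union
bounds over spanning trees, encoded as parent maps: a connected set of size `k` whose tree has all
parents in a subset of size at most `x k` contributes at most `n (O(x))^(k - 1)`, since there are only
`(x k)^(k - 1)` parent maps instead of `k^(k - 1)`. Finally, a component of `G[W]` of more than
`c log n` vertices would allow a connected set of about `η log n` vertices to be grown, a fifth of
them high; this is impossible for large `m`, as the number of edges meeting that set is at most
`c log n` (`exists_grown_absorbing`).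
-/

/-! ### Colouring the square by greedy extension and peeling -/

/-- The square of the induced subgraph `G[A]`, as a graph on all of `V` in which the vertices outside
`A` are isolated. Unlike the restriction of the square of `G` to `A`, it only uses middle vertices
that lie in `A`; keeping the vertex type fixed lets `A` shrink in an induction. -/
def SimpleGraph.squareOn {V : Type*} (G : SimpleGraph V) (A : Finset V) : SimpleGraph V where
  Adj u v := u ≠ v ∧ u ∈ A ∧ v ∈ A ∧ (G.Adj u v ∨ ∃ w ∈ A, G.Adj u w ∧ G.Adj w v)
  symm := ⟨fun _ _ ⟨hne, hu, hv, h⟩ => ⟨hne.symm, hv, hu, h.imp (fun h => h.symm)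
    fun ⟨w, hw, h1, h2⟩ => ⟨w, hw, h2.symm, h1.symm⟩⟩⟩
  loopless := ⟨fun _ h => h.1 rfl⟩

namespace SimpleGraph

section Deterministic

open Finset
open scoped Classical

variable {V : Type*}

/-- The number of neighbours of `v` in `A`; the vertex `v` itself need not lie in `A`. -/
noncomputable def degreeOn (G : SimpleGraph V) (A : Finset V) (v : V) : ℕ :=
  #{w ∈ A | G.Adj v w}

/-- `G.Grown r A` says that `A` arises from `{r}` by adding adjacent vertices one at a time, that is,
that `A` contains `r` and `G[A]` is connected. The inductive form gives spanning trees and extensions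
of connected sets without passing to subtypes. -/
inductive Grown (G : SimpleGraph V) (r : V) : Finset V → Prop
  | base : Grown G r {r}
  | step {A : Finset V} {u v : V} :
      Grown G r A → u ∈ A → v ∉ A → G.Adj u v → Grown G r (insert v A)

variable {G : SimpleGraph V}

lemma degreeOn_mono {A B : Finset V} (h : A ⊆ B) (v : V) : G.degreeOn A v ≤ G.degreeOn B v :=
  card_le_card (filter_subset_filter _ h)

lemma Grown.root_mem {r : V} {A : Finset V} (h : G.Grown r A) : r ∈ A := by
  induction h with
  | base => exact mem_singleton_self r
  | step _ _ _ _ ih => exact mem_insert_of_mem ih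

lemma Grown.subset_of_closed {r : V} {B D W : Finset V} (h : G.Grown r B) (hBW : B ⊆ W)
    (hr : r ∈ D) (hD : ∀ x ∈ D, ∀ y ∈ W, G.Adj x y → y ∈ D) : B ⊆ D := by
  induction h with
  | base => simpa using hr
  | @step A u v hA hu hv huv ih =>
    rw [insert_subset_iff] at hBW
    have := ih hBW.2
    exact insert_subset (hD u (this hu) v hBW.1 huv) this

variable [Fintype V]

/-- The closed neighbourhood of `A`: the vertices at distance at most one from `A`. Its iterate
`G.closedNbhd^[j] A` is the ball of radius `j` around `A`. -/
noncomputable def closedNbhd (G : SimpleGraph V) (A : Finset V) : Finset V :=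
  {v | v ∈ A ∨ ∃ u ∈ A, G.Adj u v}

lemma power_two_eq_squareOn_univ (G : SimpleGraph V) : G.power 2 = G.squareOn univ := by
  ext u v
  simp only [power, squareOn, mem_univ, true_and]
  refine and_congr_right fun hne => ⟨?_, ?_⟩
  · rintro ⟨w, -, hw⟩
    cases w with
    | nil => exact absurd rfl hne
    | cons h q =>
      cases q with
      | nil => exact Or.inl h
      | cons h' q' =>
        cases q' with
        | nil => exact Or.inr ⟨_, h, h'⟩
        | cons h'' q'' => simp at hw
  · rintro (h | ⟨w, h1, h2⟩)
    · exact ⟨h.toWalk, by simp [Walk.cons_isPath_iff, hne], by simp⟩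
    · exact ⟨.cons h1 (.cons h2 .nil), by simp [Walk.cons_isPath_iff, hne, h1.ne, h2.ne], by simp⟩

lemma degreeOn_univ (G : SimpleGraph V) (v : V) : G.degreeOn univ v = G.degree v := by
  rw [degreeOn, ← card_neighborFinset_eq_degree, neighborFinset_eq_filter]

/-- Greedy colouring: a proper colouring of `S` extends if every vertex outside `S` has fewer than `k`
neighbours. -/
lemma colorable_of_coloring_of_degreeOn_lt (H : SimpleGraph V) (k : ℕ) (S : Finset V)
    (c : V → Fin k) (hc : ∀ u ∈ S, ∀ v ∈ S, H.Adj u v → c u ≠ c v)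
    (h : ∀ v ∉ S, H.degreeOn univ v < k) : H.Colorable k := by
  induction hn : #Sᶜ generalizing S c with
  | zero =>
    have hS : S = univ := by simpa using hn
    subst hS
    exact ⟨Coloring.mk c fun {u v} huv => hc u (mem_univ _) v (mem_univ _) huv⟩
  | succ n ih =>
    obtain ⟨v, hv⟩ : Sᶜ.Nonempty := by rw [← card_pos]; omega
    have hvS : v ∉ S := by simpa using hv
    obtain ⟨x, hx⟩ : ∃ x, x ∉ ({w | H.Adj v w} : Finset V).image c := by
      by_contra! hall
      have h1 : (univ : Finset (Fin k)) ⊆ ({w | H.Adj v w} : Finset V).image c :=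
        fun x _ => hall x
      have h2 := (card_le_card h1).trans card_image_le
      have h3 := h v hvS
      rw [degreeOn] at h3
      simp only [card_univ, Fintype.card_fin] at h2
      omega
    have hx' : ∀ w, H.Adj v w → c w ≠ x := fun w hw hcw =>
      hx (mem_image.2 ⟨w, by simpa using hw, hcw⟩)
    refine ih (insert v S) (Function.update c v x) ?_ (fun w hw => h w fun hwS =>
      hw (mem_insert_of_mem hwS)) ?_
    · intro u hu w hw huw
      rcases eq_or_ne u v with rfl | huv
      · rw [Function.update_self, Function.update_of_ne huw.ne']
        exact (hx' w huw).symm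
      · rcases eq_or_ne w v with rfl | hwv
        · rw [Function.update_self, Function.update_of_ne huv]
          exact hx' u huw.symm
        · rw [Function.update_of_ne huv, Function.update_of_ne hwv]
          exact hc u (mem_of_mem_insert_of_ne hu huv) w (mem_of_mem_insert_of_ne hw hwv) huw
    · rw [card_compl] at hn ⊢
      rw [card_insert_of_notMem hvS]
      omega

lemma degreeOn_squareOn_le (G : SimpleGraph V) (A : Finset V) {v : V} (hv : v ∈ A) :
    (G.squareOn A).degreeOn univ v ≤ ∑ x ∈ A with G.Adj v x, G.degreeOn A x := by
  have hsub : ({w | (G.squareOn A).Adj v w} : Finset V) ⊆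
      ({x ∈ A | G.Adj v x} : Finset V).biUnion fun x => (insert x {w ∈ A | G.Adj x w}).erase v := by
    intro w hw
    obtain ⟨hne, -, hwA, h⟩ := (mem_filter.1 hw).2
    rw [mem_biUnion]
    rcases h with h | ⟨x, hx, h1, h2⟩
    · exact ⟨w, by simp [hwA, h], by simp [hne.symm]⟩
    · exact ⟨x, by simp [hx, h1], by simp [hne.symm, hwA, h2]⟩
  refine (card_le_card hsub).trans (card_biUnion_le.trans (sum_le_sum fun x hx => ?_))
  have hx := mem_filter.1 hx
  rw [card_erase_of_mem (by simp [hv, hx.2.symm]), degreeOn]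
  exact Nat.sub_le_of_le_add (card_insert_le _ _)

/-- A vertex `v` with at most one neighbour in `A` is never a middle vertex, so deleting it does not
change the square on the other vertices; and its neighbours in the square are the unique neighbour
`p` and further neighbours of `p`, hence at most `deg p` in number. -/
lemma colorable_squareOn_of_erase {k : ℕ} (hk : ∀ v, G.degree v < k) {A : Finset V} {v : V}
    (hv : v ∈ A) (h1 : G.degreeOn A v ≤ 1) (hc : (G.squareOn (A.erase v)).Colorable k) :
    (G.squareOn A).Colorable k := by
  obtain ⟨c⟩ := hc
  refine colorable_of_coloring_of_degreeOn_lt _ k (univ.erase v) c ?_ ?_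
  · rintro u hu w hw ⟨hne, huA, hwA, h⟩
    refine c.valid ⟨hne, by simp_all, by simp_all, h.imp id ?_⟩
    rintro ⟨x, hx, hux, hxw⟩
    refine ⟨x, mem_erase.2 ⟨?_, hx⟩, hux, hxw⟩
    rintro rfl
    exact hne (card_le_one.1 h1 u (by simp [huA, hux.symm]) w (by simp [hwA, hxw]))
  · intro u hu
    obtain rfl : u = v := by simpa using hu
    refine (degreeOn_squareOn_le G A hv).trans_lt ?_
    have hk0 := hk u
    rcases Nat.le_one_iff_eq_zero_or_eq_one.1 h1 with h0 | h0
    · rw [degreeOn, card_eq_zero] at h0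
      rw [h0, sum_empty]
      omega
    · rw [degreeOn, card_eq_one] at h0
      obtain ⟨p, hp⟩ := h0
      rw [hp, sum_singleton]
      exact ((degreeOn_mono (subset_univ _) p).trans_eq (degreeOn_univ G p)).trans_lt (hk p)

/-- If every component of every `G[A]`, `A ⊆ W`, has at most as many edges as vertices, then the square
of `G[W]` can be coloured with `k > max Δ 4` colours. Vertices with at most one neighbour are peeled
off; when none is left, all components are cycles, whose squares have degree at most four. -/
lemma colorable_squareOn_of_locally_unicyclic {k : ℕ} (hk : ∀ v, G.degree v < k) (hk4 : 4 < k)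
    {W : Finset V}
    (hW : ∀ A ⊆ W, ∀ v ∈ A, ∃ B ⊆ A, v ∈ B ∧ (∀ x ∈ B, ∀ y ∈ A, G.Adj x y → y ∈ B) ∧
      ∑ x ∈ B, G.degreeOn B x ≤ 2 * #B) :
    (G.squareOn W).Colorable k := by
  suffices ∀ n, ∀ A ⊆ W, #A = n → (G.squareOn A).Colorable k from this _ W subset_rfl rfl
  intro n
  induction n with
  | zero =>
    intro A _ hA
    rw [card_eq_zero] at hA
    subst hA
    exact ⟨Coloring.mk (fun _ => ⟨0, by omega⟩) fun {u v} huv => absurd huv.2.1 (by simp)⟩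
  | succ n ih =>
    intro A hAW hA
    by_cases hleaf : ∃ v ∈ A, G.degreeOn A v ≤ 1
    · obtain ⟨v, hv, h1⟩ := hleaf
      exact colorable_squareOn_of_erase hk hv h1
        (ih _ ((erase_subset _ _).trans hAW) (by rw [card_erase_of_mem hv]; omega))
    · push Not at hleaf
      have h2 : ∀ v ∈ A, G.degreeOn A v = 2 := by
        intro v hv
        obtain ⟨B, hBA, hvB, hcl, hsum⟩ := hW A hAW v hv
        have hBd : ∀ x ∈ B, G.degreeOn B x = G.degreeOn A x := by
          intro x hx
          unfold degreeOn
          congr 1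
          ext y
          simp only [mem_filter]
          exact ⟨fun h => ⟨hBA h.1, h.2⟩, fun h => ⟨hcl x hx y h.1 h.2, h.2⟩⟩
        have hge : ∀ x ∈ B, 2 ≤ G.degreeOn B x := fun x hx => by
          rw [hBd x hx]; exact hleaf x (hBA hx)
        have heq : ∑ x ∈ B, 2 = ∑ x ∈ B, G.degreeOn B x := by
          refine le_antisymm (sum_le_sum hge) (by simpa [mul_comm] using hsum)
        rw [← hBd v hvB]
        exact ((sum_eq_sum_iff_of_le hge).1 heq v hvB).symm
      refine colorable_of_coloring_of_degreeOn_lt _ k ∅ (fun _ => ⟨0, by omega⟩) (by simp) ?_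
      intro v _
      by_cases hv : v ∈ A
      · refine (degreeOn_squareOn_le G A hv).trans_lt ?_
        rw [sum_congr rfl fun x hx => h2 x (mem_filter.1 hx).1, sum_const]
        have := h2 v hv
        rw [degreeOn] at this
        rw [this]
        simpa using hk4
      · have : (G.squareOn A).degreeOn univ v = 0 := by
          rw [degreeOn, card_eq_zero, filter_eq_empty_iff]
          exact fun w _ hw => hv hw.2.1
        omega

end Deterministic

end SimpleGraph

/-! ### Connected sets around vertices of high degree -/

namespace SimpleGraph

section Growth

open Finset
open scoped Classical

variable {V : Type*} [Fintype V] {G : SimpleGraph V}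

lemma mem_closedNbhd {A : Finset V} {v : V} :
    v ∈ G.closedNbhd A ↔ v ∈ A ∨ ∃ u ∈ A, G.Adj u v := by
  simp [closedNbhd]

lemma subset_closedNbhd (A : Finset V) : A ⊆ G.closedNbhd A :=
  fun _ hv => mem_closedNbhd.2 (Or.inl hv)

lemma closedNbhd_mono {A B : Finset V} (h : A ⊆ B) : G.closedNbhd A ⊆ G.closedNbhd B := by
  intro v hv
  rw [mem_closedNbhd] at hv ⊢
  exact hv.imp (@h v) fun ⟨u, hu, huv⟩ => ⟨u, h hu, huv⟩

lemma exists_mem_closedNbhd_singleton {A : Finset V} {v : V} (hv : v ∈ G.closedNbhd A) :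
    ∃ u ∈ A, u ∈ G.closedNbhd {v} := by
  rcases mem_closedNbhd.1 hv with h | ⟨u, hu, huv⟩
  · exact ⟨v, h, mem_closedNbhd.2 (Or.inl (mem_singleton_self v))⟩
  · exact ⟨u, hu, mem_closedNbhd.2 (Or.inr ⟨v, mem_singleton_self v, huv.symm⟩)⟩

lemma Grown.insert_of_mem_closedNbhd {r v : V} {A : Finset V} (h : G.Grown r A)
    (hv : v ∈ G.closedNbhd A) : G.Grown r (insert v A) := by
  by_cases hvA : v ∈ A
  · rwa [insert_eq_of_mem hvA]
  · obtain ⟨u, hu, huv⟩ := (mem_closedNbhd.1 hv).resolve_left hvA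
    exact h.step hu hvA huv

lemma Grown.of_subset_closedNbhd {r : V} {A B : Finset V} (h : G.Grown r A) (hAB : A ⊆ B)
    (hB : B ⊆ G.closedNbhd A) : G.Grown r B := by
  suffices ∀ D : Finset V, D ⊆ G.closedNbhd A → G.Grown r (D ∪ A) by
    simpa [union_eq_left.2 hAB] using this B hB
  intro D
  induction D using Finset.induction_on with
  | empty => intro _; simpa using h
  | insert v D _ ih =>
    intro hD
    rw [insert_subset_iff] at hD
    rw [insert_union]
    exact (ih hD.2).insert_of_mem_closedNbhd (closedNbhd_mono subset_union_right hD.1)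

/-- A connected set absorbs a vertex at distance at most `j` at the cost of `j` new vertices. -/
lemma Grown.exists_grown_mem_iterate {r : V} {A : Finset V} (h : G.Grown r A) (j : ℕ) {v : V}
    (hv : v ∈ G.closedNbhd^[j] A) : ∃ B, A ⊆ B ∧ v ∈ B ∧ G.Grown r B ∧ #B ≤ #A + j := by
  induction j generalizing v with
  | zero => exact ⟨A, subset_rfl, hv, h, le_rfl⟩
  | succ j ih =>
    rw [Function.iterate_succ_apply'] at hv
    rcases mem_closedNbhd.1 hv with hv | ⟨u, hu, huv⟩
    · obtain ⟨B, h1, h2, h3, h4⟩ := ih hv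
      exact ⟨B, h1, h2, h3, by omega⟩
    · obtain ⟨B, h1, h2, h3, h4⟩ := ih hu
      refine ⟨insert v B, h1.trans (subset_insert _ _), mem_insert_self _ _,
        h3.insert_of_mem_closedNbhd (mem_closedNbhd.2 (Or.inr ⟨u, h2, huv⟩)), ?_⟩
      have := card_insert_le v B
      omega

lemma sum_degree_le_sum_degreeOn_closedNbhd (A : Finset V) :
    ∑ v ∈ A, G.degree v ≤ ∑ v ∈ G.closedNbhd A, G.degreeOn (G.closedNbhd A) v := by
  refine le_trans (sum_le_sum fun v hv => ?_) (sum_le_sum_of_subset (subset_closedNbhd A))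
  rw [← degreeOn_univ]
  refine card_le_card fun w hw => ?_
  have hw := (mem_filter.1 hw).2
  exact mem_filter.2 ⟨mem_closedNbhd.2 (Or.inr ⟨v, hv, hw⟩), hw⟩

/-- The vertices of degree greater than `m`. -/
noncomputable def highDegree (G : SimpleGraph V) (m : ℕ) : Finset V := {v | m < G.degree v}

/-- If connected sets expand slowly and are sparse, then every vertex `l` of degree greater than `m`
lies in a small connected set `Q` that contains all vertices of degree greater than `m` within
distance five of `Q`. Such a `Q` is taken maximal among the connected sets in which at least a fifth
of the vertices have degree greater than `m`: absorbing one more such vertex would push `Q` beyond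
size `q`, so that `Q` would see more than `2 N` edge ends inside its closed neighbourhood, which has
at most `N` vertices and hence at most `N` edges. -/
lemma exists_grown_absorbing {m N q : ℕ}
    (hedge : ∀ r A, G.Grown r A → #A ≤ N → ∑ x ∈ A, G.degreeOn A x ≤ 2 * #A)
    (hexp : ∀ r A, G.Grown r A → #A ≤ q → #(G.closedNbhd A) ≤ N)
    (hq : 1 ≤ q) (hm : 10 * N < (m + 1) * (q - 4)) {l : V} (hl : l ∈ G.highDegree m) :
    ∃ Q, G.Grown l Q ∧ #Q ≤ q ∧ ∀ x ∈ G.closedNbhd^[5] Q, x ∈ G.highDegree m → x ∈ Q := by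
  have hne : ({Q | G.Grown l Q ∧ #Q ≤ 5 * #(Q ∩ G.highDegree m) ∧ #Q ≤ q} :
      Finset (Finset V)).Nonempty := by
    refine ⟨{l}, mem_filter.2 ⟨mem_univ _, .base, ?_, by simpa using hq⟩⟩
    rw [singleton_inter_of_mem hl]
    simp
  obtain ⟨Q, hQ, hmax⟩ := exists_max_image _ (fun Q : Finset V => #Q) hne
  obtain ⟨hg, h5, hQq⟩ := (mem_filter.1 hQ).2
  refine ⟨Q, hg, hQq, fun x hx hxL => ?_⟩
  by_contra hxQ
  obtain ⟨B, hQB, hxB, hgB, hBc⟩ := hg.exists_grown_mem_iterate 5 hx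
  have hlt : #Q < #B := card_lt_card ⟨hQB, fun h => hxQ (h hxB)⟩
  have hBL : #(Q ∩ G.highDegree m) + 1 ≤ #(B ∩ G.highDegree m) := by
    refine Nat.succ_le_of_lt (card_lt_card ⟨inter_subset_inter_right hQB, fun h => hxQ ?_⟩)
    exact (mem_inter.1 (h (mem_inter.2 ⟨hxB, hxL⟩))).1
  have hBq : q < #B := by
    by_contra! hle
    exact absurd (hmax B (mem_filter.2 ⟨mem_univ _, hgB, by omega, hle⟩)) (by omega)
  have hN := hexp l Q hg hQq
  have hsum : (m + 1) * #(Q ∩ G.highDegree m) ≤ 2 * N := by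
    calc (m + 1) * #(Q ∩ G.highDegree m)
        = ∑ v ∈ Q ∩ G.highDegree m, (m + 1) := by rw [sum_const, smul_eq_mul, mul_comm]
      _ ≤ ∑ v ∈ Q ∩ G.highDegree m, G.degree v :=
          sum_le_sum fun v hv => (mem_filter.1 (mem_inter.1 hv).2).2
      _ ≤ ∑ v ∈ Q, G.degree v := sum_le_sum_of_subset inter_subset_left
      _ ≤ _ := sum_degree_le_sum_degreeOn_closedNbhd Q
      _ ≤ 2 * #(G.closedNbhd Q) :=
          hedge l _ (hg.of_subset_closedNbhd (subset_closedNbhd Q) subset_rfl) hN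
      _ ≤ 2 * N := by omega
  have : (m + 1) * (q - 4) ≤ (m + 1) * (5 * #(Q ∩ G.highDegree m)) :=
    Nat.mul_le_mul_left _ (by omega)
  nlinarith

/-- The connected component of `v` in `G[A]`. -/
lemma exists_closed_grown (A : Finset V) {v : V} (hv : v ∈ A) :
    ∃ B ⊆ A, G.Grown v B ∧ ∀ x ∈ B, ∀ y ∈ A, G.Adj x y → y ∈ B := by
  have hne : ({B | B ⊆ A ∧ G.Grown v B} : Finset (Finset V)).Nonempty :=
    ⟨{v}, mem_filter.2 ⟨mem_univ _, by simpa using hv, .base⟩⟩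
  obtain ⟨B, hB, hmax⟩ := exists_max_image _ (fun B : Finset V => #B) hne
  obtain ⟨hBA, hg⟩ := (mem_filter.1 hB).2
  refine ⟨B, hBA, hg, fun x hx y hy hxy => ?_⟩
  by_contra hyB
  have := hmax (insert y B) (mem_filter.2 ⟨mem_univ _,
    insert_subset hy hBA, hg.step hx hyB hxy⟩)
  rw [card_insert_of_notMem hyB] at this
  omega

lemma closedNbhd_iterate_mono {A B : Finset V} (h : A ⊆ B) (j : ℕ) :
    G.closedNbhd^[j] A ⊆ G.closedNbhd^[j] B := by
  induction j with
  | zero => exact h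
  | succ j ih =>
    rw [Function.iterate_succ_apply', Function.iterate_succ_apply']
    exact closedNbhd_mono ih

lemma mem_iterate_closedNbhd_singleton_of_mem {j : ℕ} {A : Finset V} {v : V}
    (hv : v ∈ G.closedNbhd^[j] A) : ∃ u ∈ A, u ∈ G.closedNbhd^[j] {v} := by
  induction j generalizing v with
  | zero => exact ⟨v, hv, mem_singleton_self v⟩
  | succ j ih =>
    rw [Function.iterate_succ_apply'] at hv
    obtain ⟨w, hw, hwv⟩ := exists_mem_closedNbhd_singleton hv
    obtain ⟨u, hu, huw⟩ := ih hw
    refine ⟨u, hu, ?_⟩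
    rw [Function.iterate_succ_apply]
    exact closedNbhd_iterate_mono (singleton_subset_iff.2 hwv) j huw

/-- Components of the graph induced on vertices within distance two of `G.highDegree m` are sparse:
they lie in the ball of radius two around the set `Q` of `exists_grown_absorbing`, because a vertex
of the component next to that ball is within distance two of a vertex of high degree, which is then
within distance five of `Q` and so in `Q`. -/
lemma exists_component_near_highDegree {m N q q' : ℕ}
    (hedge : ∀ r A, G.Grown r A → #A ≤ N → ∑ x ∈ A, G.degreeOn A x ≤ 2 * #A)
    (hexp : ∀ r A, G.Grown r A → #A ≤ q' → #(G.closedNbhd A) ≤ N)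
    (hexp' : ∀ r A, G.Grown r A → #A ≤ q → #(G.closedNbhd A) ≤ q')
    (hq : 1 ≤ q) (hqq : q ≤ q') (hm : 10 * N < (m + 1) * (q - 4)) {A : Finset V}
    (hA : A ⊆ G.closedNbhd^[2] (G.highDegree m)) {v : V} (hv : v ∈ A) :
    ∃ B ⊆ A, v ∈ B ∧ (∀ x ∈ B, ∀ y ∈ A, G.Adj x y → y ∈ B) ∧
      ∑ x ∈ B, G.degreeOn B x ≤ 2 * #B := by
  obtain ⟨l, hl, hlv⟩ := mem_iterate_closedNbhd_singleton_of_mem (hA hv)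
  obtain ⟨Q, hg, hQq, habs⟩ := exists_grown_absorbing hedge
    (fun r A h hA => hexp r A h (hA.trans hqq)) hq hm hl
  obtain ⟨B, hBA, hgB, hcl⟩ := exists_closed_grown (G := G) A hv
  have hvQ : v ∈ G.closedNbhd^[2] Q := by
    obtain ⟨w, hw, hwl⟩ := mem_iterate_closedNbhd_singleton_of_mem hlv
    rw [mem_singleton.1 hw] at hwl
    exact closedNbhd_iterate_mono (singleton_subset_iff.2 hg.root_mem) 2 hwl
  have hBQ : B ⊆ G.closedNbhd^[2] Q := by
    refine hgB.subset_of_closed (hBA.trans hA) hvQ fun x hx y hy hxy => ?_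
    have hy3 : y ∈ G.closedNbhd^[3] Q := by
      rw [Function.iterate_succ_apply']
      exact mem_closedNbhd.2 (Or.inr ⟨x, hx, hxy⟩)
    obtain ⟨z, hz, hzy⟩ := mem_iterate_closedNbhd_singleton_of_mem hy
    have hzQ : z ∈ Q := by
      refine habs z ?_ hz
      rw [show (5 : ℕ) = 2 + 3 from rfl, Function.iterate_add_apply]
      exact closedNbhd_iterate_mono (singleton_subset_iff.2 hy3) 2 hzy
    obtain ⟨w, hw, hwz⟩ := mem_iterate_closedNbhd_singleton_of_mem hzy
    rw [mem_singleton.1 hw] at hwz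
    exact closedNbhd_iterate_mono (singleton_subset_iff.2 hzQ) 2 hwz
  refine ⟨B, hBA, hgB.root_mem, hcl, hedge v B hgB ((card_le_card hBQ).trans ?_)⟩
  exact hexp l _ (hg.of_subset_closedNbhd (subset_closedNbhd Q) subset_rfl) (hexp' l Q hg hQq)

/-- The deterministic part of the upper bound. A vertex at distance at least two from
`G.highDegree m` has at most `m * m` neighbours in the square, so it can be coloured last. For the
other vertices, the square only uses middle vertices within distance two of `G.highDegree m`. -/
theorem power_two_colorable {m N q q' k : ℕ}
    (hedge : ∀ r A, G.Grown r A → #A ≤ N → ∑ x ∈ A, G.degreeOn A x ≤ 2 * #A)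
    (hexp : ∀ r A, G.Grown r A → #A ≤ q' → #(G.closedNbhd A) ≤ N)
    (hexp' : ∀ r A, G.Grown r A → #A ≤ q → #(G.closedNbhd A) ≤ q')
    (hq : 1 ≤ q) (hqq : q ≤ q') (hm : 10 * N < (m + 1) * (q - 4))
    (hk : ∀ v, G.degree v < k) (hk4 : 4 < k) (hkm : m * m < k) :
    (G.power 2).Colorable k := by
  obtain ⟨c⟩ := colorable_squareOn_of_locally_unicyclic hk hk4
    (W := G.closedNbhd^[2] (G.highDegree m)) fun A hA v hv =>
      exists_component_near_highDegree hedge hexp hexp' hq hqq hm hA hv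
  rw [power_two_eq_squareOn_univ]
  refine colorable_of_coloring_of_degreeOn_lt _ k (G.closedNbhd (G.highDegree m)) c ?_ ?_
  · rintro u hu w hw ⟨hne, -, -, h⟩
    refine c.valid ⟨hne, subset_closedNbhd _ hu, subset_closedNbhd _ hw, h.imp id ?_⟩
    rintro ⟨x, -, hux, hxw⟩
    exact ⟨x, mem_closedNbhd.2 (Or.inr ⟨u, hu, hux⟩), hux, hxw⟩
  · intro v hv
    rw [mem_closedNbhd, not_or] at hv
    have hlow : ∀ w, w ∉ G.highDegree m → G.degreeOn univ w ≤ m := fun w hw => by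
      rw [degreeOn_univ]
      simpa [highDegree] using hw
    refine ((degreeOn_squareOn_le G univ (mem_univ v)).trans ?_).trans_lt hkm
    refine (sum_le_card_nsmul _ _ m fun x hx => hlow x fun hxL => ?_).trans ?_
    · exact hv.2 ⟨x, hxL, (mem_filter.1 hx).2.symm⟩
    · rw [smul_eq_mul]
      exact Nat.mul_le_mul_right _ (hlow v hv.1)

/-- A vertex and its neighbours are pairwise at distance at most two. -/
lemma maxDegree_succ_le_chromaticNumber_power_two (G : SimpleGraph V) [Nonempty V] :
    (G.maxDegree : ℕ∞) + 1 ≤ (G.power 2).chromaticNumber := by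
  obtain ⟨v, hv⟩ := G.exists_maximal_degree_vertex
  have hcl : (G.power 2).IsClique (insert v (G.neighborFinset v) : Finset V) := by
    rw [power_two_eq_squareOn_univ]
    intro x hx y hy hne
    refine ⟨hne, mem_univ _, mem_univ _, ?_⟩
    simp only [coe_insert, coe_neighborFinset, Set.mem_insert_iff, mem_neighborSet] at hx hy
    rcases hx with rfl | hx
    · rcases hy with rfl | hy
      · exact absurd rfl hne
      · exact Or.inl hy
    · rcases hy with rfl | hy
      · exact Or.inl hx.symm
      · exact Or.inr ⟨v, mem_univ _, hx.symm, hy⟩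
  have := hcl.card_le_chromaticNumber
  rw [card_insert_of_notMem (by simp), card_neighborFinset_eq_degree, ← hv] at this
  exact_mod_cast this

end Growth

end SimpleGraph

/-! ### Edge probabilities in the binomial random graph -/

namespace SimpleGraph

section EdgeProbabilities

open Finset Measure unitInterval

/-- The Bernoulli distribution on `Prop` that gives mass `p` to `True`. -/
noncomputable def bernoulliProp (p : I) : Measure Prop :=
  toNNReal p • dirac True + toNNReal (σ p) • dirac False

instance (p : I) : IsProbabilityMeasure (bernoulliProp p) := by
  unfold bernoulliProp
  infer_instance

lemma bernoulliProp_real_true (p : I) : (bernoulliProp p).real {True} = p := by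
  simp [bernoulliProp, measureReal_def]

lemma bernoulliProp_real_false (p : I) : (bernoulliProp p).real {False} = 1 - p := by
  simp [bernoulliProp, measureReal_def]

variable {V : Type*} [Fintype V]

/-- The indicators of distinct potential edges are independent Bernoulli variables. -/
lemma binomialRandom_setOf_mem_edgeSet (p : I) {ι : Type*} [Fintype ι] {e : ι → Sym2 V}
    (he : Function.Injective e) (hd : ∀ i, ¬ (e i).IsDiag) (S : Set (ι → Prop)) :
    binomialRandom V p {G | (fun i => e i ∈ G.edgeSet) ∈ S} =
      Measure.pi (fun _ : ι => bernoulliProp p) S := by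
  have hS : MeasurableSet S := S.toFinite.measurableSet
  have hm : Measurable fun G : SimpleGraph V => fun i => e i ∈ G.edgeSet :=
    measurable_pi_iff.2 fun i => (measurable_set_mem (e i)).comp measurable_edgeSet
  have h := map_infinitePi_infinitePi_of_inj (P := fun i : Sym2 V =>
    (toNNReal p • dirac (i ∈ (Sym2.diagSet : Set (Sym2 V))ᶜ) + toNNReal (σ p) • dirac False :
      Measure Prop)) he
  have h2 : (fun i => (toNNReal p • dirac (e i ∈ (Sym2.diagSet : Set (Sym2 V))ᶜ) +
      toNNReal (σ p) • dirac False : Measure Prop)) = fun _ => bernoulliProp p := by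
    funext i
    simp [bernoulliProp, hd i]
  have hT : MeasurableSet {G : SimpleGraph V | (fun i => e i ∈ G.edgeSet) ∈ S} := hm hS
  rw [← infinitePi_eq_pi]
  rw [h2] at h
  rw [← h, binomialRandom_eq_map, ProbabilityTheory.setBernoulli_eq_map,
    map_apply measurable_fromEdgeSet hT, map_apply (by fun_prop)
      (measurable_fromEdgeSet hT), map_apply (by fun_prop) hS]
  congr 1
  ext ω
  simp [hd]

/-- Diagonal elements of `F` only make the event impossible, so they need not be excluded. -/
lemma binomialRandom_real_subset_edgeSet_le (p : I) (F : Finset (Sym2 V)) :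
    (binomialRandom V p).real {G | (F : Set (Sym2 V)) ⊆ G.edgeSet} ≤ (p : ℝ) ^ #F := by
  by_cases hF : ∀ e ∈ F, ¬ e.IsDiag
  · have h := binomialRandom_setOf_mem_edgeSet p (e := fun i : F => (i : Sym2 V))
      Subtype.val_injective (fun i => hF i i.2) (Set.univ.pi fun _ => {True})
    rw [Measure.pi_pi] at h
    have h2 : {G : SimpleGraph V | (F : Set (Sym2 V)) ⊆ G.edgeSet} =
        {G | (fun i : F => (i : Sym2 V) ∈ G.edgeSet) ∈ (Set.univ.pi fun _ => {True})} := by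
      ext G
      simp [Set.subset_def]
    rw [h2, measureReal_def, h, ENNReal.toReal_prod]
    simp_rw [← measureReal_def, bernoulliProp_real_true]
    simp
  · push Not at hF
    obtain ⟨e, heF, he⟩ := hF
    have : {G : SimpleGraph V | (F : Set (Sym2 V)) ⊆ G.edgeSet} = ∅ := by
      ext G
      simp only [Set.mem_ofPred_eq, Set.mem_empty_iff_false, iff_false]
      exact fun h => G.not_isDiag_of_mem_edgeSet (h heF) he
    rw [this]
    simpa using pow_nonneg p.2.1 _

/-- First-moment bound: every graph in `S` contains one of the edge sets `F i`, all of size `t`. -/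
lemma binomialRandom_real_exists_subset_edgeSet_le (p : I) {κ : Type*} (s : Finset κ)
    (F : κ → Finset (Sym2 V)) {t : ℕ} (ht : ∀ i ∈ s, #(F i) = t) {S : Set (SimpleGraph V)}
    (hS : ∀ G ∈ S, ∃ i ∈ s, (F i : Set (Sym2 V)) ⊆ G.edgeSet) :
    (binomialRandom V p).real S ≤ #s * (p : ℝ) ^ t := by
  calc (binomialRandom V p).real S
      ≤ (binomialRandom V p).real (⋃ i ∈ s, {G | (F i : Set (Sym2 V)) ⊆ G.edgeSet}) :=
        measureReal_mono (fun G hG => by simpa using hS G hG) (measure_ne_top _ _)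
    _ ≤ ∑ i ∈ s, (binomialRandom V p).real {G | (F i : Set (Sym2 V)) ⊆ G.edgeSet} :=
        measureReal_biUnion_finset_le _ _
    _ ≤ ∑ i ∈ s, (p : ℝ) ^ t := sum_le_sum fun i hi =>
        (binomialRandom_real_subset_edgeSet_le p (F i)).trans_eq (by rw [ht i hi])
    _ = #s * (p : ℝ) ^ t := by rw [sum_const, nsmul_eq_mul]

lemma pi_real_compl_pi {ι α : Type*} [Fintype ι] [Finite ι] [MeasurableSpace α]
    (μ : Measure α) [IsProbabilityMeasure μ] {S : Set α} (hS : MeasurableSet S) :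
    (Measure.pi fun _ : ι => μ).real (Set.univ.pi fun _ => S)ᶜ =
      1 - μ.real S ^ Fintype.card ι := by
  rw [probReal_compl_eq_one_sub (MeasurableSet.univ_pi fun _ => hS), measureReal_def,
    Measure.pi_pi, ENNReal.toReal_prod]
  simp [measureReal_def]

/-- The vertices `w` are divided into `M` blocks of size `b`. The probability that each `u i` misses
some block entirely is a product over `i`, as edges at different `u i` are independent. -/
lemma binomialRandom_real_forall_exists_forall_not_adj (p : I) {a M b : ℕ} {u : Fin a → V}
    {w : Fin M × Fin b → V} (hu : Function.Injective u) (hw : Function.Injective w)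
    (huw : ∀ i j, u i ≠ w j) :
    (binomialRandom V p).real {G | ∀ i, ∃ j, ∀ t, ¬ G.Adj (u i) (w (j, t))} =
      (1 - (1 - (1 - (p : ℝ)) ^ b) ^ M) ^ a := by
  have hinj : Function.Injective fun x : Fin a × Fin M × Fin b => s(u x.1, w x.2) := by
    rintro ⟨i, x⟩ ⟨i', x'⟩ h
    rcases Sym2.eq_iff.1 h with ⟨h1, h2⟩ | ⟨h1, -⟩
    · rw [Prod.mk.injEq]
      exact ⟨hu h1, hw h2⟩
    · exact absurd h1 (huw _ _)
  let ν := bernoulliProp p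
  let C : Set (Fin b → Prop) := (Set.univ.pi fun _ => {False})ᶜ
  let B : Set (Fin M → Fin b → Prop) := (Set.univ.pi fun _ => C)ᶜ
  let Z : Set (Fin a → Fin M → Fin b → Prop) := Set.univ.pi fun _ => B
  have hC : MeasurableSet C := (MeasurableSet.univ_pi fun _ => by measurability).compl
  have hB : MeasurableSet B := (MeasurableSet.univ_pi fun _ => hC).compl
  have hZ : MeasurableSet Z := MeasurableSet.univ_pi fun _ => hB
  have hset : {G : SimpleGraph V | ∀ i, ∃ j, ∀ t, ¬ G.Adj (u i) (w (j, t))} =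
      {G | (fun x : Fin a × Fin M × Fin b => s(u x.1, w x.2) ∈ G.edgeSet) ∈
        {f | (fun i j t => f (i, j, t)) ∈ Z}} := by
    ext G
    simp [Z, B, C, Set.mem_pi]
  have hmap : (Measure.pi fun _ : Fin a × Fin M × Fin b => ν) {f | (fun i j t => f (i, j, t)) ∈ Z} =
      (Measure.pi fun _ : Fin a => Measure.pi fun _ : Fin M => Measure.pi fun _ : Fin b => ν) Z := by
    have h1 := infinitePi_map_curry (fun (_ : Fin a) (_ : Fin M × Fin b) => ν)
    have h2 := infinitePi_map_curry (fun (_ : Fin M) (_ : Fin b) => ν)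
    have h3 := infinitePi_map_pi (μ := fun _ : Fin a => infinitePi fun _ : Fin M × Fin b => ν)
      (f := fun _ => MeasurableEquiv.curry (Fin M) (Fin b) Prop) (fun _ => by fun_prop)
    rw [h2] at h3
    simp only [infinitePi_eq_pi] at h1 h3
    rw [← h1] at h3
    rw [← h3, map_apply (by fun_prop) hZ, map_apply (by fun_prop) (by measurability)]
    rfl
  rw [hset, measureReal_def, binomialRandom_setOf_mem_edgeSet p hinj
    (fun x => by simpa using huw _ _), hmap, Measure.pi_pi, ENNReal.toReal_prod]
  simp_rw [← measureReal_def]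
  simp only [B, prod_const, card_univ, Fintype.card_fin]
  rw [pi_real_compl_pi _ hC, pi_real_compl_pi _ (by measurability), bernoulliProp_real_false]
  simp

end EdgeProbabilities

end SimpleGraph

/-! ### Counting spanning trees -/

namespace SimpleGraph

section SpanningTrees

open Finset unitInterval
open scoped Classical

variable {V : Type*} {G : SimpleGraph V}

/-- The spanning tree produced by the growth: each vertex points to the vertex it was attached to,
and distinct vertices give distinct edges. -/
lemma Grown.exists_parent {r : V} {A : Finset V} (h : G.Grown r A) :
    ∃ π : V → V, (∀ v ∈ A, v ≠ r → π v ∈ A ∧ G.Adj v (π v)) ∧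
      Set.InjOn (fun v => s(v, π v)) (A.erase r : Finset V) := by
  induction h with
  | base => exact ⟨id, by simp, by simp⟩
  | @step A u v hA hu hv huv ih =>
    obtain ⟨π, hπ, hinj⟩ := ih
    have hne : ∀ x ∈ A, x ≠ v := fun x hx hxv => hv (hxv ▸ hx)
    refine ⟨Function.update π v u, ?_, ?_⟩
    · intro x hx hxr
      rcases mem_insert.1 hx with rfl | hx
      · rw [Function.update_self]
        exact ⟨mem_insert_of_mem hu, huv.symm⟩
      · rw [Function.update_of_ne (hne x hx)]
        exact ⟨mem_insert_of_mem (hπ x hx hxr).1, (hπ x hx hxr).2⟩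
    · -- The new edge is the only one that contains the new vertex.
      have hnew : ∀ x ∈ A, x ≠ r → s(v, u) ≠ s(x, π x) := by
        intro x hx hxr heq
        rcases Sym2.eq_iff.1 heq with ⟨h1, -⟩ | ⟨h1, -⟩
        · exact hv (h1 ▸ hx)
        · exact hv (h1 ▸ (hπ x hx hxr).1)
      intro x hx y hy hxy
      obtain ⟨hxr, hx⟩ := mem_erase.1 hx
      obtain ⟨hyr, hy⟩ := mem_erase.1 hy
      rcases mem_insert.1 hx with hxv | hxA <;> rcases mem_insert.1 hy with hyv | hyA
      · exact hxv.trans hyv.symm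
      · subst hxv
        simp only [Function.update_self, Function.update_of_ne (hne y hyA)] at hxy
        exact absurd hxy (hnew y hyA hyr)
      · subst hyv
        simp only [Function.update_self, Function.update_of_ne (hne x hxA)] at hxy
        exact absurd hxy.symm (hnew x hxA hxr)
      · simp only [Function.update_of_ne (hne x hxA), Function.update_of_ne (hne y hyA)] at hxy
        exact hinj (by simp [hxA, hxr]) (by simp [hyA, hyr]) hxy

variable [Fintype V]

/-- Candidate parent maps: every vertex of `B` other than the root `r` has a parent in `A`. Outside
`B.erase r` the map takes the dummy value `r`, so that only the values on `B.erase r`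
are counted. -/
noncomputable def parentMaps (A B : Finset V) (r : V) : Finset (V → V) :=
  Fintype.piFinset fun v => if v ∈ B.erase r then A else {r}

/-- The edges joining the vertices of `B.erase r` to their parents. -/
noncomputable def parentEdges (B : Finset V) (r : V) (π : V → V) : Finset (Sym2 V) :=
  (B.erase r).image fun v => s(v, π v)

lemma card_parentMaps (A : Finset V) {B : Finset V} {r : V} (hr : r ∈ B) :
    #(parentMaps A B r) = #A ^ (#B - 1) := by
  rw [parentMaps, Fintype.card_piFinset]
  simp_rw [apply_ite card, card_singleton]
  rw [prod_ite, prod_const_one, mul_one, prod_const, filter_mem_eq_inter, univ_inter,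
    card_erase_of_mem hr]

/-- If `A` is connected and `A ⊆ B ⊆ N[A]`, then `B` has a spanning tree in which all parents lie in
`A`. For small `A` there are few such trees, which is what makes expansion unlikely. -/
lemma Grown.exists_mem_parentMaps {r : V} {A B : Finset V} (h : G.Grown r A) (hAB : A ⊆ B)
    (hB : B ⊆ G.closedNbhd A) :
    ∃ π ∈ parentMaps A B r, #(parentEdges B r π) = #B - 1 ∧
      (parentEdges B r π : Set (Sym2 V)) ⊆ G.edgeSet ∧ parentEdges B r π ⊆ B.sym2 := by
  obtain ⟨π, hπ, hinj⟩ := h.exists_parent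
  have hnb : ∀ v ∈ B, v ∉ A → ∃ u ∈ A, G.Adj v u := fun v hv hvA => by
    obtain ⟨u, hu, huv⟩ := (mem_closedNbhd.1 (hB hv)).resolve_left hvA
    exact ⟨u, hu, huv.symm⟩
  choose! f hf using hnb
  let ρ : V → V := fun v => if v ∈ B.erase r then if v ∈ A then π v else f v else r
  have hρ : ∀ v ∈ B.erase r, ρ v ∈ A ∧ G.Adj v (ρ v) ∧ (v ∈ A → ρ v = π v) := by
    intro v hv
    obtain ⟨hvr, hvB⟩ := mem_erase.1 hv
    simp only [ρ, if_pos hv]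
    by_cases hvA : v ∈ A
    · simp only [if_pos hvA]
      exact ⟨(hπ v hvA hvr).1, (hπ v hvA hvr).2, fun _ => trivial⟩
    · simp only [if_neg hvA]
      exact ⟨(hf v hvB hvA).1, (hf v hvB hvA).2, fun h => absurd h hvA⟩
  have hρinj : Set.InjOn (fun v => s(v, ρ v)) (B.erase r : Finset V) := by
    intro x hx y hy hxy
    obtain ⟨hx1, -, hx3⟩ := hρ x hx
    obtain ⟨hy1, -, hy3⟩ := hρ y hy
    rcases Sym2.eq_iff.1 hxy with ⟨h1, -⟩ | ⟨h1, h2⟩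
    · exact h1
    · have hxA : x ∈ A := h1 ▸ hy1
      have hyA : y ∈ A := h2 ▸ hx1
      simp only [hx3 hxA, hy3 hyA] at hxy
      exact hinj (mem_erase.2 ⟨(mem_erase.1 hx).1, hxA⟩)
        (mem_erase.2 ⟨(mem_erase.1 hy).1, hyA⟩) hxy
  refine ⟨ρ, ?_, ?_, ?_, ?_⟩
  · rw [parentMaps, Fintype.mem_piFinset]
    intro v
    by_cases hv : v ∈ B.erase r
    · rw [if_pos hv]
      exact (hρ v hv).1
    · rw [if_neg hv]
      simp only [ρ, if_neg hv, mem_singleton]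
  · rw [parentEdges, card_image_of_injOn hρinj, card_erase_of_mem (hAB h.root_mem)]
  · rintro e he
    obtain ⟨v, hv, rfl⟩ := mem_image.1 (mem_coe.1 he)
    exact (hρ v hv).2.1
  · rintro e he
    obtain ⟨v, hv, rfl⟩ := mem_image.1 he
    exact mk_mem_sym2_iff.2 ⟨mem_of_mem_erase hv, hAB (hρ v hv).1⟩

/-- The handshaking lemma for `G[A]`. -/
lemma sum_degreeOn_eq (G : SimpleGraph V) (A : Finset V) :
    ∑ x ∈ A, G.degreeOn A x = 2 * #{e ∈ A.sym2 | e ∈ G.edgeSet} := by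
  obtain ⟨H, hH⟩ : ∃ H : SimpleGraph V, ∀ u v, H.Adj u v ↔ u ∈ A ∧ v ∈ A ∧ G.Adj u v :=
    ⟨{ Adj := fun u v => u ∈ A ∧ v ∈ A ∧ G.Adj u v
       symm := ⟨fun _ _ h => ⟨h.2.1, h.1, h.2.2.symm⟩⟩
       loopless := ⟨fun _ h => h.2.2.ne rfl⟩ }, fun _ _ => Iff.rfl⟩
  have h1 := H.sum_degrees_eq_twice_card_edges
  have h2 : H.edgeFinset = {e ∈ A.sym2 | e ∈ G.edgeSet} := by
    ext e
    induction e with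
    | _ u v => simp [hH, and_assoc]
  rw [← h2, ← h1, ← sum_subset (subset_univ A)]
  · refine sum_congr rfl fun x hx => ?_
    rw [← degreeOn_univ, degreeOn, degreeOn]
    congr 1
    ext y
    simp [hH, hx]
  · intro x _ hx
    rw [← degreeOn_univ, degreeOn, card_eq_zero, filter_eq_empty_iff]
    exact fun y _ hy => hx ((hH x y).1 hy).1

/-- A connected set with more edges than vertices contains a spanning tree and two further edges. -/
lemma Grown.exists_two_extra_edges {r : V} {A : Finset V} (h : G.Grown r A)
    (hsum : 2 * #A < ∑ x ∈ A, G.degreeOn A x) :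
    ∃ π ∈ parentMaps A A r, ∃ e ∈ A.sym2, ∃ e' ∈ A.sym2,
      #(parentEdges A r π ∪ {e, e'}) = #A + 1 ∧
      ((parentEdges A r π ∪ {e, e'} : Finset (Sym2 V)) : Set (Sym2 V)) ⊆ G.edgeSet := by
  obtain ⟨π, hπ, hcard, hsub, hsym⟩ := h.exists_mem_parentMaps subset_rfl (subset_closedNbhd A)
  have hpos : 0 < #A := card_pos.2 ⟨r, h.root_mem⟩
  have hPE : parentEdges A r π ⊆ {e ∈ A.sym2 | e ∈ G.edgeSet} := fun e he =>
    mem_filter.2 ⟨hsym he, hsub he⟩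
  rw [sum_degreeOn_eq] at hsum
  have hlt : 1 < #({e ∈ A.sym2 | e ∈ G.edgeSet} \ parentEdges A r π) := by
    rw [card_sdiff_of_subset hPE]
    omega
  obtain ⟨e, he, e', he', hne⟩ := one_lt_card.1 hlt
  rw [Finset.mem_sdiff, mem_filter] at he he'
  refine ⟨π, hπ, e, he.1.1, e', he'.1.1, ?_, ?_⟩
  · rw [card_union_of_disjoint, card_pair hne, hcard]
    · omega
    · simp [he.2, he'.2]
  · simp only [coe_union, coe_insert, coe_singleton, Set.union_subset_iff, Set.insert_subset_iff,
      Set.singleton_subset_iff]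
    exact ⟨hsub, he.1.2, he'.1.2⟩

/-- Union bound over a set `B` of size `k`, a dominating subset `A` of `B` of size at most `j`, a root
and a parent map from `B` to `A`. -/
lemma binomialRandom_real_exists_large_closedNbhd_le (p : I) {j k : ℕ} (hjk : j ≤ k) :
    (binomialRandom V p).real {G | ∃ r A, G.Grown r A ∧ #A ≤ j ∧ k ≤ #(G.closedNbhd A)} ≤
      ((Fintype.card V).choose k * (2 ^ k * (k * j ^ (k - 1))) : ℕ) * (p : ℝ) ^ (k - 1) := by
  let s : Finset ((B : Finset V) × (A : Finset V) × (r : V) × (V → V)) :=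
    (powersetCard k univ).sigma fun B => {A ∈ B.powerset | #A ≤ j}.sigma fun A =>
      A.sigma fun r => {π ∈ parentMaps A B r | #(parentEdges B r π) = k - 1}
  have hs : #s ≤ (Fintype.card V).choose k * (2 ^ k * (k * j ^ (k - 1))) := by
    rw [card_sigma, ← card_univ, ← card_powersetCard, ← smul_eq_mul]
    refine sum_le_card_nsmul _ _ _ fun B hB => ?_
    have hBk := (mem_powersetCard.1 hB).2
    rw [card_sigma]
    refine (sum_le_card_nsmul _ _ (k * j ^ (k - 1)) fun A hA => ?_).trans ?_
    · obtain ⟨hAB, hAj⟩ := mem_filter.1 hA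
      rw [mem_powerset] at hAB
      rw [card_sigma]
      refine (sum_le_card_nsmul _ _ (j ^ (k - 1)) fun r hr => ?_).trans ?_
      · refine (card_le_card (filter_subset _ _)).trans ?_
        rw [card_parentMaps A (hAB hr), hBk]
        exact Nat.pow_le_pow_left hAj _
      · rw [smul_eq_mul]
        exact Nat.mul_le_mul_right _ (hAj.trans hjk)
    · rw [smul_eq_mul]
      refine Nat.mul_le_mul_right _ ((card_le_card (filter_subset _ _)).trans_eq ?_)
      rw [card_powerset, hBk]
  refine (binomialRandom_real_exists_subset_edgeSet_le p s
    (fun x => parentEdges x.1 x.2.2.1 x.2.2.2) (t := k - 1) ?_ ?_).trans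
    (mul_le_mul_of_nonneg_right (by exact_mod_cast hs) (pow_nonneg p.2.1 _))
  · rintro ⟨B, A, r, π⟩ hx
    simp only [s, mem_sigma, mem_filter] at hx
    exact hx.2.2.2.2
  · rintro G ⟨r, A, hg, hAj, hk⟩
    obtain ⟨B, hAB, hBN, hBk⟩ :=
      exists_subsuperset_card_eq (subset_closedNbhd A) (hAj.trans hjk) hk
    obtain ⟨π, hπ, hcard, hsub, -⟩ := hg.exists_mem_parentMaps hAB hBN
    refine ⟨⟨B, A, r, π⟩, ?_, hsub⟩
    simp only [s, mem_sigma, mem_filter, mem_powersetCard, mem_powerset]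
    exact ⟨⟨subset_univ _, hBk⟩, ⟨hAB, hAj⟩, hg.root_mem, hπ, hcard.trans (by rw [hBk])⟩

/-- Union bound over a set of size `k`, a spanning tree of it and two further edges. -/
lemma binomialRandom_real_exists_bicyclic_le (p : I) (k : ℕ) :
    (binomialRandom V p).real
        {G | ∃ r A, G.Grown r A ∧ #A = k ∧ 2 * #A < ∑ x ∈ A, G.degreeOn A x} ≤
      ((Fintype.card V).choose k * (k ^ k * (k ^ 2) ^ 2) : ℕ) * (p : ℝ) ^ (k + 1) := by
  let s : Finset ((A : Finset V) × (r : V) × (V → V) × (Sym2 V) × (Sym2 V)) :=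
    {x ∈ (powersetCard k univ).sigma fun A => A.sigma fun r =>
      parentMaps A A r ×ˢ A.sym2 ×ˢ A.sym2 |
        #(parentEdges x.1 x.2.1 x.2.2.1 ∪ {x.2.2.2.1, x.2.2.2.2}) = k + 1}
  have hs : #s ≤ (Fintype.card V).choose k * (k ^ k * (k ^ 2) ^ 2) := by
    refine (card_le_card (filter_subset _ _)).trans ?_
    rw [card_sigma, ← card_univ, ← card_powersetCard, ← smul_eq_mul]
    refine sum_le_card_nsmul _ _ _ fun A hA => ?_
    have hAk := (mem_powersetCard.1 hA).2
    have hsym : #A.sym2 ≤ k ^ 2 := by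
      rw [card_sym2, hAk, Nat.choose_two_right]
      refine Nat.div_le_of_le_mul ?_
      rcases Nat.eq_zero_or_pos k with rfl | hk
      · simp
      · simp only [Nat.add_sub_cancel]
        nlinarith
    rw [card_sigma]
    refine (sum_le_card_nsmul _ _ (k ^ (k - 1) * (k ^ 2) ^ 2) fun r hr => ?_).trans ?_
    · rw [card_product, card_product, card_parentMaps A hr, hAk, sq (k ^ 2)]
      exact Nat.mul_le_mul_left _ (Nat.mul_le_mul hsym hsym)
    · rw [smul_eq_mul, hAk, ← mul_assoc]
      refine Nat.mul_le_mul_right _ ?_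
      rcases Nat.eq_zero_or_pos k with rfl | hk
      · simp
      · rw [mul_pow_sub_one hk.ne']
  refine (binomialRandom_real_exists_subset_edgeSet_le p s
    (fun x => parentEdges x.1 x.2.1 x.2.2.1 ∪ {x.2.2.2.1, x.2.2.2.2}) (t := k + 1) ?_ ?_).trans
    (mul_le_mul_of_nonneg_right (by exact_mod_cast hs) (pow_nonneg p.2.1 _))
  · exact fun x hx => (mem_filter.1 hx).2
  · rintro G ⟨r, A, hg, hk, hsum⟩
    obtain ⟨π, hπ, e, he, e', he', hcard, hsub⟩ := hg.exists_two_extra_edges hsum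
    refine ⟨⟨A, r, π, e, e'⟩, ?_, hsub⟩
    simp only [s, mem_sigma, mem_filter, mem_powersetCard, mem_product]
    exact ⟨⟨⟨subset_univ _, hk⟩, hg.root_mem, hπ, he, he'⟩, hcard.trans (by rw [hk])⟩

end SpanningTrees

end SimpleGraph

/-! ### Events of high probability -/

namespace SimpleGraph

section Asymptotics

open Finset unitInterval
open scoped Classical

lemma choose_mul_pow_self_le (n k : ℕ) :
    (n.choose k : ℝ) * (k : ℝ) ^ k ≤ (Real.exp 1 * n) ^ k := by
  have h1 : (n.choose k : ℝ) ≤ (n : ℝ) ^ k / k.factorial := Nat.choose_le_pow_div k n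
  have h2 : (k : ℝ) ^ k / k.factorial ≤ Real.exp k :=
    Real.pow_div_factorial_le_exp _ (Nat.cast_nonneg k) k
  calc (n.choose k : ℝ) * (k : ℝ) ^ k ≤ (n : ℝ) ^ k / k.factorial * (k : ℝ) ^ k := by gcongr
    _ = (n : ℝ) ^ k * ((k : ℝ) ^ k / k.factorial) := by ring
    _ ≤ (n : ℝ) ^ k * Real.exp k := by gcongr
    _ = (Real.exp 1 * n) ^ k := by rw [mul_pow, ← Real.exp_nat_mul, mul_one]; ring

lemma expansion_count_le {d x : ℝ} (hd : 0 < d) (hx : 0 < x) {n k : ℕ} (hn : 0 < n)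
    (hk : 0 < k) :
    ((n.choose k * (2 ^ k * (k * ⌊x * k⌋₊ ^ (k - 1))) : ℕ) : ℝ) * (d / n) ^ (k - 1) ≤
      2 * Real.exp 1 * n * (2 * Real.exp 1 * d * x) ^ (k - 1) := by
  have hj : (⌊x * k⌋₊ : ℝ) ≤ x * k := Nat.floor_le (by positivity)
  have hn' : (n : ℝ) ≠ 0 := by positivity
  obtain ⟨l, rfl⟩ : ∃ l, k = l + 1 := ⟨k - 1, by omega⟩
  rw [Nat.add_sub_cancel]
  push_cast at hj ⊢
  calc (n.choose (l + 1) : ℝ) * (2 ^ (l + 1) * (((l : ℝ) + 1) * (⌊x * (l + 1)⌋₊ : ℝ) ^ l)) *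
        (d / n) ^ l
      ≤ (n.choose (l + 1) : ℝ) * (2 ^ (l + 1) * (((l : ℝ) + 1) * (x * (l + 1)) ^ l)) *
        (d / n) ^ l := by gcongr
    _ = ((n.choose (l + 1) : ℝ) * ((l + 1 : ℕ) : ℝ) ^ (l + 1)) * 2 ^ (l + 1) * x ^ l *
        (d / n) ^ l := by rw [mul_pow]; push_cast; ring
    _ ≤ (Real.exp 1 * n) ^ (l + 1) * 2 ^ (l + 1) * x ^ l * (d / n) ^ l := by
        gcongr
        exact choose_mul_pow_self_le n (l + 1)
    _ = 2 * Real.exp 1 * n * (2 * Real.exp 1 * d * x) ^ l := by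
        simp only [pow_succ, mul_pow, div_pow]
        field_simp

lemma bicyclic_count_le {d s : ℝ} (hd : 0 < d) (hs : 0 ≤ s) (hds : d ≤ Real.exp s) {n k N : ℕ}
    (hn : 0 < n) (hk : k ≤ N) :
    ((n.choose k * (k ^ k * (k ^ 2) ^ 2) : ℕ) : ℝ) * (d / n) ^ (k + 1) ≤
      d / n * Real.exp ((5 + s) * N) := by
  have hn' : (n : ℝ) ≠ 0 := by positivity
  have hkexp : (k : ℝ) ≤ Real.exp k := by linarith [Real.add_one_le_exp (k : ℝ)]
  push_cast
  calc (n.choose k : ℝ) * ((k : ℝ) ^ k * ((k : ℝ) ^ 2) ^ 2) * (d / n) ^ (k + 1)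
      = ((n.choose k : ℝ) * (k : ℝ) ^ k) * (k : ℝ) ^ 4 * (d / n) ^ (k + 1) := by ring
    _ ≤ (Real.exp 1 * n) ^ k * (Real.exp k) ^ 4 * (d / n) ^ (k + 1) := by
        gcongr
        exact choose_mul_pow_self_le n k
    _ = d / n * (Real.exp 1 ^ k * Real.exp k ^ 4 * d ^ k) := by
        simp only [pow_succ, mul_pow, div_pow]
        field_simp
    _ ≤ d / n * (Real.exp 1 ^ k * Real.exp k ^ 4 * Real.exp s ^ k) := by gcongr
    _ = d / n * Real.exp ((5 + s) * k) := by
        rw [← Real.exp_nat_mul, ← Real.exp_nat_mul, ← Real.exp_nat_mul, ← Real.exp_add,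
          ← Real.exp_add]
        congr 2
        push_cast
        ring
    _ ≤ d / n * Real.exp ((5 + s) * N) := by gcongr

variable {d : ℝ} {p : ℕ → I}

/-- Slow expansion: for small `x`, with high probability no connected set of size at most `x * K n`
has a closed neighbourhood of size `K n`, when `K n` is at least of order `log n`. -/
lemma exists_expansion (hd : 0 < d) (hp : ∀ᶠ n : ℕ in atTop, (p n : ℝ) = d / (n : ℝ))
    {ε : ℝ} (hε : 0 < ε) {K : ℕ → ℕ} (hK : ∀ᶠ n : ℕ in atTop, ε * Real.log n ≤ K n) :
    ∃ x : ℝ, 0 < x ∧ x ≤ 1 / 2 ∧ Tendsto (fun n : ℕ => (binomialRandom (Fin n) (p n)).real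
      {G | ∃ r A, G.Grown r A ∧ #A ≤ ⌊x * K n⌋₊ ∧ K n ≤ #(G.closedNbhd A)}) atTop (𝓝 0) := by
  have he := Real.exp_pos 1
  -- This `x` makes the base of the geometric factor in `expansion_count_le` at most `exp (-2 / ε)`,
  -- so that its `K n`-th power is at most `n⁻²`.
  refine ⟨min (1 / 2) (Real.exp (-2 / ε) / (2 * Real.exp 1 * d)), by positivity,
    min_le_left _ _, ?_⟩
  set x := min (1 / 2) (Real.exp (-2 / ε) / (2 * Real.exp 1 * d)) with hx
  have hx0 : 0 < x := by positivity
  have hxd : 2 * Real.exp 1 * d * x ≤ Real.exp (-2 / ε) := by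
    calc 2 * Real.exp 1 * d * x
        ≤ 2 * Real.exp 1 * d * (Real.exp (-2 / ε) / (2 * Real.exp 1 * d)) := by
          gcongr
          exact min_le_right _ _
      _ = Real.exp (-2 / ε) := by field_simp
  have hlim : Tendsto (fun n : ℕ => 2 * Real.exp 1 * Real.exp (2 / ε) / (n : ℝ)) atTop (𝓝 0) :=
    tendsto_const_div_atTop_nhds_zero_nat _
  refine squeeze_zero' (Eventually.of_forall fun n => measureReal_nonneg) ?_ hlim
  filter_upwards [hp, hK, eventually_ge_atTop 2] with n hpn hKn hn2
  have hn0 : (0 : ℝ) < n := by positivity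
  have hlog : 0 < Real.log n := Real.log_pos (by exact_mod_cast hn2)
  have hK0 : 0 < K n := by
    have : (0 : ℝ) < K n := lt_of_lt_of_le (by positivity) hKn
    exact_mod_cast this
  have hfl : ⌊x * K n⌋₊ ≤ K n := by
    refine Nat.floor_le_of_le ?_
    have : x ≤ 1 := (min_le_left _ _).trans (by norm_num)
    nlinarith [(Nat.cast_nonneg (K n) : (0 : ℝ) ≤ K n)]
  refine (binomialRandom_real_exists_large_closedNbhd_le (p n) hfl).trans ?_
  rw [Fintype.card_fin, hpn]
  refine (expansion_count_le hd hx0 (by omega) hK0).trans ?_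
  have hpow : (2 * Real.exp 1 * d * x) ^ (K n - 1) ≤ Real.exp (2 / ε) / (n : ℝ) ^ 2 := by
    calc (2 * Real.exp 1 * d * x) ^ (K n - 1) ≤ Real.exp (-2 / ε) ^ (K n - 1) := by gcongr
      _ = Real.exp (2 / ε - 2 / ε * K n) := by
          rw [← Real.exp_nat_mul, Nat.cast_sub hK0]
          congr 1
          push_cast
          ring
      _ ≤ Real.exp (2 / ε - 2 * Real.log n) := by
          refine Real.exp_le_exp.2 (sub_le_sub_left ?_ _)
          calc 2 * Real.log n = 2 / ε * (ε * Real.log n) := by field_simp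
            _ ≤ 2 / ε * K n := by gcongr
      _ = Real.exp (2 / ε) / (n : ℝ) ^ 2 := by
          rw [Real.exp_sub, two_mul, Real.exp_add, Real.exp_log hn0, sq]
  calc 2 * Real.exp 1 * n * (2 * Real.exp 1 * d * x) ^ (K n - 1)
      ≤ 2 * Real.exp 1 * n * (Real.exp (2 / ε) / (n : ℝ) ^ 2) := by gcongr
    _ = 2 * Real.exp 1 * Real.exp (2 / ε) / (n : ℝ) := by field_simp

/-- With high probability every connected set of size at most `c * log n` has at most as many edges as
vertices. -/
lemma exists_locally_unicyclic (hd : 0 < d)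
    (hp : ∀ᶠ n : ℕ in atTop, (p n : ℝ) = d / (n : ℝ)) :
    ∃ c : ℝ, 0 < c ∧ Tendsto (fun n : ℕ => (binomialRandom (Fin n) (p n)).real
      {G | ∃ r A, G.Grown r A ∧ #A ≤ ⌊c * Real.log n⌋₊ ∧
        2 * #A < ∑ x ∈ A, G.degreeOn A x}) atTop (𝓝 0) := by
  obtain ⟨s, hs, hds⟩ : ∃ s, 0 ≤ s ∧ d ≤ Real.exp s :=
    ⟨d, hd.le, by linarith [Real.add_one_le_exp d]⟩
  -- The union bound is at most `d / n * exp ((6 + s) * N)`; this constant makes it `O(n ^ (-1 / 2))`.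
  refine ⟨1 / (2 * (6 + s)), by positivity, ?_⟩
  have hlim : Tendsto (fun n : ℕ => d * Real.exp (-(Real.log n / 2))) atTop (𝓝 0) := by
    have h1 : Tendsto (fun n : ℕ => Real.log n / 2) atTop atTop :=
      (Real.tendsto_log_atTop.comp tendsto_natCast_atTop_atTop).atTop_div_const (by norm_num)
    simpa using (Real.tendsto_exp_neg_atTop_nhds_zero.comp h1).const_mul d
  refine squeeze_zero' (Eventually.of_forall fun n => measureReal_nonneg) ?_ hlim
  filter_upwards [hp, eventually_ge_atTop 2] with n hpn hn2
  have hn0 : (0 : ℝ) < n := by positivity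
  have hlog : 0 < Real.log n := Real.log_pos (by exact_mod_cast hn2)
  set N := ⌊1 / (2 * (6 + s)) * Real.log n⌋₊ with hN
  have hNle : (6 + s) * N ≤ Real.log n / 2 := by
    have h1 : (N : ℝ) ≤ 1 / (2 * (6 + s)) * Real.log n := Nat.floor_le (by positivity)
    calc (6 + s) * N ≤ (6 + s) * (1 / (2 * (6 + s)) * Real.log n) := by gcongr
      _ = Real.log n / 2 := by field_simp
  calc (binomialRandom (Fin n) (p n)).real
        {G | ∃ r A, G.Grown r A ∧ #A ≤ N ∧ 2 * #A < ∑ x ∈ A, G.degreeOn A x}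
      ≤ (binomialRandom (Fin n) (p n)).real (⋃ k ∈ range (N + 1),
          {G | ∃ r A, G.Grown r A ∧ #A = k ∧ 2 * #A < ∑ x ∈ A, G.degreeOn A x}) := by
        refine measureReal_mono ?_ (measure_ne_top _ _)
        rintro G ⟨r, A, hg, hA, hsum⟩
        exact Set.mem_biUnion (x := #A) (by simpa [Nat.lt_succ_iff] using hA) ⟨r, A, hg, rfl, hsum⟩
    _ ≤ ∑ k ∈ range (N + 1), (binomialRandom (Fin n) (p n)).real
          {G | ∃ r A, G.Grown r A ∧ #A = k ∧ 2 * #A < ∑ x ∈ A, G.degreeOn A x} :=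
        measureReal_biUnion_finset_le _ _
    _ ≤ ∑ k ∈ range (N + 1), d / n * Real.exp ((5 + s) * N) := by
        refine sum_le_sum fun k hk => (binomialRandom_real_exists_bicyclic_le (p n) k).trans ?_
        rw [Fintype.card_fin, hpn]
        exact bicyclic_count_le hd hs hds (by omega) (by simpa [Nat.lt_succ_iff] using hk)
    _ = (N + 1) * (d / n * Real.exp ((5 + s) * N)) := by
        rw [sum_const, card_range, nsmul_eq_mul]
        push_cast
        ring
    _ ≤ Real.exp N * (d / n * Real.exp ((5 + s) * N)) := by
        gcongr
        exact Real.add_one_le_exp _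
    _ = d / n * Real.exp ((6 + s) * N) := by
        rw [show (6 + s) * (N : ℝ) = N + (5 + s) * N by ring, Real.exp_add]
        ring
    _ ≤ d / n * Real.exp (Real.log n / 2) := by gcongr
    _ = d * Real.exp (-(Real.log n / 2)) := by
        have h1 : Real.exp (Real.log n / 2) * Real.exp (Real.log n / 2) = n := by
          rw [← Real.exp_add, add_halves, Real.exp_log hn0]
        rw [Real.exp_neg]
        have h2 := Real.exp_pos (Real.log n / 2)
        field_simp
        rw [sq, h1]

/-- The maximum degree is unbounded: for each of the first `n / 2` vertices independently, with
probability bounded below, it has a neighbour in each of `M` blocks of the remaining vertices. -/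
lemma tendsto_forall_degree_lt (hd : 0 < d)
    (hp : ∀ᶠ n : ℕ in atTop, (p n : ℝ) = d / (n : ℝ)) {M : ℕ} (hM : 0 < M) :
    Tendsto (fun n : ℕ => (binomialRandom (Fin n) (p n)).real {G | ∀ v, G.degree v < M})
      atTop (𝓝 0) := by
  set κ : ℝ := (1 - Real.exp (-(d / (4 * M)))) ^ M with hκ
  have hexp : Real.exp (-(d / (4 * M))) < 1 := Real.exp_lt_one_iff.2 (by
    have : 0 < d / (4 * M) := by positivity
    linarith)
  have hκ0 : 0 < κ := pow_pos (by linarith) _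
  have hκ1 : κ ≤ 1 := pow_le_one₀ (by linarith) (by linarith [Real.exp_pos (-(d / (4 * M)))])
  have hlim : Tendsto (fun n : ℕ => (1 - κ) ^ (n / 2)) atTop (𝓝 0) :=
    (tendsto_pow_atTop_nhds_zero_of_lt_one (by linarith) (by linarith)).comp
      (Nat.tendsto_div_const_atTop (by norm_num))
  refine squeeze_zero' (Eventually.of_forall fun n => measureReal_nonneg) ?_ hlim
  filter_upwards [hp, eventually_ge_atTop (4 * M)] with n hpn hn
  have hn0 : (0 : ℝ) < n := by
    have : 0 < n := by omega
    exact_mod_cast this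
  set b := n / 2 / M with hb
  have hbM : M * b ≤ n / 2 := Nat.mul_div_le _ _
  let u : Fin (n / 2) → Fin n := Fin.castLE (by omega)
  let w : Fin M × Fin b → Fin n := fun x =>
    Fin.castLE (by omega) (Fin.natAdd (n / 2) (finProdFinEquiv x))
  have hu : Function.Injective u := Fin.castLE_injective _
  have hw : Function.Injective w := (Fin.castLE_injective _).comp
    ((Fin.natAdd_injective _ _).comp finProdFinEquiv.injective)
  have huw : ∀ i j, u i ≠ w j := by
    intro i j h
    have := congrArg Fin.val h
    simp only [u, w, Fin.val_castLE, Fin.val_natAdd] at this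
    omega
  calc (binomialRandom (Fin n) (p n)).real {G | ∀ v, G.degree v < M}
      ≤ (binomialRandom (Fin n) (p n)).real
          {G | ∀ i, ∃ j, ∀ t, ¬ G.Adj (u i) (w (j, t))} := by
        refine measureReal_mono (fun G hG i => ?_) (measure_ne_top _ _)
        by_contra! hall
        choose t ht using hall
        have hinj : Function.Injective fun j => w (j, t j) := fun j j' h =>
          congrArg Prod.fst (hw h)
        have h1 : #(univ.image fun j => w (j, t j)) ≤ G.degree (u i) := by
          rw [← degreeOn_univ]
          refine card_le_card fun y hy => ?_
          obtain ⟨j, -, rfl⟩ := mem_image.1 hy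
          exact mem_filter.2 ⟨mem_univ _, ht j⟩
        rw [card_image_of_injective _ hinj, card_univ, Fintype.card_fin] at h1
        exact absurd (hG (u i)) (by omega)
    _ = (1 - (1 - (1 - (p n : ℝ)) ^ b) ^ M) ^ (n / 2) :=
        binomialRandom_real_forall_exists_forall_not_adj (p n) hu hw huw
    _ ≤ (1 - κ) ^ (n / 2) := by
        have hp0 : (0 : ℝ) ≤ p n := (p n).2.1
        have hp1 : (p n : ℝ) ≤ 1 := (p n).2.2
        have hb4 : (n : ℝ) ≤ 4 * M * b := by
          have h1 : n / 2 < M * b + M := by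
            have := Nat.lt_mul_div_succ (n / 2) hM
            rw [← hb] at this
            linarith
          have h2 : n ≤ 4 * (M * b) := by omega
          calc (n : ℝ) ≤ ((4 * (M * b) : ℕ) : ℝ) := by exact_mod_cast h2
            _ = 4 * M * b := by push_cast; ring
        have h1 : (1 - (p n : ℝ)) ^ b ≤ Real.exp (-(d / (4 * M))) := by
          calc (1 - (p n : ℝ)) ^ b ≤ Real.exp (-(p n : ℝ)) ^ b := by
                exact pow_le_pow_left₀ (by linarith) (Real.one_sub_le_exp_neg _) _
            _ = Real.exp (-(d / n * b)) := by
                rw [← Real.exp_nat_mul, hpn]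
                congr 1
                ring
            _ ≤ Real.exp (-(d / (4 * M))) := by
                gcongr
                rw [div_mul_eq_mul_div, div_le_div_iff₀ (by positivity) hn0]
                nlinarith
        have h2 : κ ≤ (1 - (1 - (p n : ℝ)) ^ b) ^ M :=
          pow_le_pow_left₀ (by linarith) (by linarith) _
        have h3 : (1 - (1 - (p n : ℝ)) ^ b) ^ M ≤ 1 :=
          pow_le_one₀ (by linarith) (by linarith [pow_nonneg (sub_nonneg.2 hp1) b])
        exact pow_le_pow_left₀ (by linarith) (by linarith) _

end Asymptotics

end SimpleGraph

/-! ### Asymptotic colouring -/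

namespace SimpleGraph

section Conclusion

open Finset
open scoped Classical

/-- The radii `N`, `q'`, `q` are of order `log n`, so that a constant `m` suffices in
`exists_grown_absorbing`. -/
lemma eventually_radius_bounds {c x y : ℝ} (hc : 0 < c) (hx : 0 < x) (hy : 0 < y) (hx1 : x ≤ 1 / 2)
    (hy1 : y ≤ 1 / 2) {m : ℕ} (hm : 40 / (x * y) ≤ m) :
    ∀ᶠ n : ℕ in atTop, ∀ N q' q : ℕ, N = ⌊c * Real.log n⌋₊ → q' = ⌊x * (N + 1 : ℕ)⌋₊ →
      q = ⌊y * (q' + 1 : ℕ)⌋₊ → 1 ≤ q ∧ q ≤ q' ∧ 10 * N < (m + 1) * (q - 4) := by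
  have hlog : Tendsto (fun n : ℕ => Real.log n) atTop atTop :=
    Real.tendsto_log_atTop.comp tendsto_natCast_atTop_atTop
  filter_upwards [hlog.eventually_ge_atTop (10 / (x * y * c))] with n hn N q' q hN hq' hq
  have hL : 10 ≤ x * y * c * Real.log n := by
    rw [div_le_iff₀ (by positivity)] at hn
    linarith
  have hlog0 : 0 < Real.log n := lt_of_lt_of_le (by positivity) hn
  have hN1 : (N : ℝ) ≤ c * Real.log n := hN ▸ Nat.floor_le (by positivity)
  have hN2 : c * Real.log n ≤ (N + 1 : ℕ) := by
    rw [hN]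
    exact_mod_cast (Nat.lt_floor_add_one _).le
  have hq'1 : x * (N + 1 : ℕ) ≤ (q' + 1 : ℕ) := by
    rw [hq']
    exact_mod_cast (Nat.lt_floor_add_one _).le
  have hq1 : y * (q' + 1 : ℕ) < (q : ℝ) + 1 := by
    rw [hq]
    exact Nat.lt_floor_add_one _
  have hq2 : (q : ℝ) ≤ y * (q' + 1 : ℕ) := hq ▸ Nat.floor_le (by positivity)
  have hlow : x * y * c * Real.log n < q + 1 := by
    calc x * y * c * Real.log n = y * (x * (c * Real.log n)) := by ring
      _ ≤ y * (x * (N + 1 : ℕ)) := by gcongr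
      _ ≤ y * (q' + 1 : ℕ) := by gcongr
      _ < q + 1 := hq1
  have hq9 : (9 : ℝ) < q := by linarith
  have hq9' : 9 < q := by exact_mod_cast hq9
  refine ⟨by omega, ?_, ?_⟩
  · have h1 : (q : ℝ) ≤ 1 / 2 * (q' + 1 : ℕ) := hq2.trans (by gcongr)
    push_cast at h1
    have h2 : (2 * q : ℝ) ≤ q' + 1 := by linarith
    have h3 : 2 * q ≤ q' + 1 := by exact_mod_cast h2
    omega
  · have h4 : ((q - 4 : ℕ) : ℝ) = q - 4 := by
      rw [Nat.cast_sub (by omega)]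
      norm_num
    have h5 : x * y * c * Real.log n / 2 ≤ ((q - 4 : ℕ) : ℝ) := by
      rw [h4]
      linarith
    have h6 : (10 * N : ℝ) < (m + 1) * ((q - 4 : ℕ) : ℝ) := by
      calc (10 * N : ℝ) ≤ 10 * (c * Real.log n) := by gcongr
        _ < 20 * (c * Real.log n) := by
          have : 0 < c * Real.log n := by positivity
          linarith
        _ = 40 / (x * y) * (x * y * c * Real.log n / 2) := by
          field_simp
          norm_num
        _ ≤ (m + 1) * (x * y * c * Real.log n / 2) := by
          gcongr
          linarith
        _ ≤ (m + 1) * ((q - 4 : ℕ) : ℝ) := by gcongr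
    exact_mod_cast h6

end Conclusion

end SimpleGraph

open Classical in
theorem theorem2 (d : ℝ) (hd : 0 < d) (p : ℕ → unitInterval)
    (hp : ∀ᶠ n : ℕ in atTop, (p n : ℝ) = d / (n : ℝ)) :
    Tendsto
      (fun n : ℕ => SimpleGraph.binomialRandom (Fin n) (p n)
        {G : SimpleGraph (Fin n) | (G.power 2).chromaticNumber = (G.maxDegree : ℕ∞) + 1})
      atTop (𝓝 1) := by
  obtain ⟨c, hc, hsparse⟩ := SimpleGraph.exists_locally_unicyclic hd hp
  let N : ℕ → ℕ := fun n => ⌊c * Real.log n⌋₊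
  obtain ⟨x, hx, hx1, hexp⟩ := SimpleGraph.exists_expansion hd hp hc (K := fun n => N n + 1)
    (Eventually.of_forall fun n => by exact_mod_cast (Nat.lt_floor_add_one _).le)
  let q' : ℕ → ℕ := fun n => ⌊x * (N n + 1 : ℕ)⌋₊
  obtain ⟨y, hy, hy1, hexp'⟩ := SimpleGraph.exists_expansion hd hp (mul_pos hx hc)
    (K := fun n => q' n + 1) (Eventually.of_forall fun n => by
      calc x * c * Real.log n = x * (c * Real.log n) := by ring
        _ ≤ x * (N n + 1 : ℕ) := by
          gcongr
          exact_mod_cast (Nat.lt_floor_add_one _).le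
        _ ≤ (q' n + 1 : ℕ) := by exact_mod_cast (Nat.lt_floor_add_one _).le)
  obtain ⟨m, hm⟩ := exists_nat_ge (40 / (x * y))
  have hdeg := SimpleGraph.tendsto_forall_degree_lt hd hp (M := m * m + 4) (by omega)
  have hbad := ((hsparse.add hexp).add hexp').add hdeg
  simp only [add_zero] at hbad
  rw [← ENNReal.tendsto_toReal_iff (fun n => measure_ne_top _ _) ENNReal.one_ne_top,
    ENNReal.toReal_one]
  refine tendsto_of_tendsto_of_tendsto_of_le_of_le' (by simpa using hbad.const_sub 1)
    tendsto_const_nhds ?_ (Eventually.of_forall fun n => measureReal_le_one)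
  filter_upwards [SimpleGraph.eventually_radius_bounds hc hx hy hx1 hy1 hm,
    eventually_ge_atTop 1] with n hn hn1
  obtain ⟨hq, hqq, hmq⟩ := hn (N n) (q' n) _ rfl rfl rfl
  have : Nonempty (Fin n) := ⟨⟨0, hn1⟩⟩
  rw [sub_le_iff_le_add]
  refine (probReal_univ (μ := SimpleGraph.binomialRandom (Fin n) (p n))).ge.trans ?_
  -- A graph outside the four exceptional events satisfies all hypotheses of `power_two_colorable`.
  refine le_trans (measureReal_mono (fun G _ => ?_) (measure_ne_top _ _)) <|
    (measureReal_union_le _ _).trans <| add_le_add le_rfl <|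
    (measureReal_union_le _ _).trans <| add_le_add ((measureReal_union_le _ _).trans <|
      add_le_add (measureReal_union_le _ _) le_rfl) le_rfl
  by_contra hG
  simp only [Set.mem_union, not_or, Set.mem_ofPred_eq] at hG
  obtain ⟨hchi, ⟨⟨h1, h2⟩, h3⟩, h4⟩ := hG
  push Not at h1 h2 h3 h4
  refine hchi (le_antisymm ?_ G.maxDegree_succ_le_chromaticNumber_power_two)
  obtain ⟨v, hv⟩ := h4
  have hvΔ := G.degree_le_maxDegree v
  have hcol : (G.power 2).Colorable (G.maxDegree + 1) := by
    refine SimpleGraph.power_two_colorable (N := N n) (q' := q' n) h1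
      (fun r A hA hAq => h2 r A hA (by exact_mod_cast hAq))
      (fun r A hA hAq => h3 r A hA (by exact_mod_cast hAq)) hq hqq hmq
      (fun u => Nat.lt_succ_iff.2 (by convert G.degree_le_maxDegree u)) ?_ ?_
    · have h5 : m * m + 4 ≤ G.maxDegree := hv.trans (by convert hvΔ)
      omega
    · have h5 : m * m + 4 ≤ G.maxDegree := hv.trans (by convert hvΔ)
      omega
  exact_mod_cast hcol.chromaticNumber_le
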